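/- Let $L\ge 2$ be an even integer and let $\Lambda=\mathbb{Z}/L\mathbb{Z}$ be the one-dimensional lattice with periodic boundary conditions, $|\Lambda|=L$, with sublattice $\Lambda'=\{0,2,\dots,L-2\}$. On the fermionic Fock space with modes $(i,\sigma)$, $i\in\Lambda$, $\sigma\in\{\uparrow,\downarrow\}$, let $a_{i\sigma}^\dagger$, $a_{i\sigma}$ be the creation and annihilation operators, $n_{i\sigma}=a_{i\sigma}^\dagger a_{i\sigma}$, and $h_{ij\sigma}=a_{i\sigma}^\dagger a_{j\sigma}+a_{j\sigma}^\dagger a_{i\sigma}$. For $v,u\in\mathbb{R}$ let $$H_{\mathrm{FH}}=v\sum_{i\in\Lambda}\sum_{\sigma}h_{i,i+1,\sigma}+u\sum_{i\in\Lambda}n_{i\uparrow}n_{i\downarrow}$$ be the Fermi-Hubbard Hamiltonian (the nearest-neighbour bonds being the $L$ pairs $\{i,i+1\}$, $i\in\Lambda$), decomposed as $H_{\mathrm{FH}}=H_1+H_2+H_3$ into even-odd hopping, odd-even hopping and interaction: $$H_1=v\sum_{i\in\Lambda'}\sum_\sigma h_{i,i+1,\sigma},\qquad H_2=v\sum_{i\in\Lambda'}\sum_\sigma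 h_{i-1,i,\sigma},\qquad H_3=u\sum_{i\in\Lambda'}\bigl(n_{i\uparrow}n_{i\downarrow}+n_{i+1,\uparrow}n_{i+1,\downarrow}\bigr).$$ Let $$\mathscr{S}_2(t)=e^{-itH_1/2}e^{-itH_2/2}e^{-itH_3/2}e^{-itH_3/2}e^{-itH_2/2}e^{-itH_1/2}$$ be the Strang (second-order Suzuki) formula. Then for every $t\ge 0$, with $\|\cdot\|$ the spectral norm, $$\frac{1}{|\Lambda|}\bigl\|\mathscr{S}_2(t)-e^{-itH_{\mathrm{FH}}}\bigr\|\le\frac{t^3}{6}\left(3|v|^3+4|v|^2|u|+|v||u|^2\right).$$ -/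

import Mathlib

open scoped Matrix Matrix.Norms.L2Operator

noncomputable section

namespace FermiHubbard

/-- A fermionic mode of the periodic chain `ℤ/L`: a lattice site and a spin orientation
(`0` for spin up, `1` for spin down). -/
abbrev Mode (L : ℕ) : Type := ZMod L × Fin 2

/-- The position of a mode in the Jordan-Wigner ordering. -/
def modeIndex {L : ℕ} (p : Mode L) : ℕ := 2 * p.1.val + p.2.val

/-- Operators on the fermionic Fock space of the chain, as matrices in the occupation number
basis; the basis states are labelled by the finite sets of occupied modes. -/
abbrev FockOp (L : ℕ) : Type := Matrix (Finset (Mode L)) (Finset (Mode L)) ℂ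

/-- The fermionic annihilation operator `a_{iσ}`: it sends the basis state `t` to `0` if the mode
is empty in `t`, and otherwise to `(-1)^k` times the state with the mode removed, where `k` is the
number of occupied modes of `t` that precede it. -/
def annihilate {L : ℕ} (i : ZMod L) (σ : Fin 2) : FockOp L :=
  Matrix.of fun s t =>
    if (i, σ) ∈ t ∧ s = t.erase (i, σ) then
      (-1 : ℂ) ^ (t.filter fun q => modeIndex q < modeIndex (i, σ)).card
    else 0

/-- The creation operator `a_{iσ}†`. -/
def create {L : ℕ} (i : ZMod L) (σ : Fin 2) : FockOp L := (annihilate i σ)ᴴ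

/-- The number operator `n_{iσ}`. -/
def number {L : ℕ} [NeZero L] (i : ZMod L) (σ : Fin 2) : FockOp L := create i σ * annihilate i σ

/-- The hopping term `h_{ijσ}`. -/
def hopping {L : ℕ} [NeZero L] (i j : ZMod L) (σ : Fin 2) : FockOp L :=
  create i σ * annihilate j σ + create j σ * annihilate i σ

/-- The Fermi-Hubbard Hamiltonian on the periodic chain. The nearest-neighbour bonds of the chain
are the `L` pairs `{i, i + 1}` with `i` in `ℤ/L`. -/
def hamiltonian (L : ℕ) [NeZero L] (v u : ℝ) : FockOp L :=
  (v : ℂ) • ∑ i : ZMod L, ∑ σ : Fin 2, hopping i (i + 1) σ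
    + (u : ℂ) • ∑ i : ZMod L, number i 0 * number i 1

/-- The sublattice `{0, 2, …, L - 2}` (for even `L`). -/
def evenSites (L : ℕ) [NeZero L] : Finset (ZMod L) :=
  Finset.univ.filter fun i => Even i.val

/-- Even-odd hopping. -/
def H1 (L : ℕ) [NeZero L] (v : ℝ) : FockOp L :=
  (v : ℂ) • ∑ i ∈ evenSites L, ∑ σ : Fin 2, hopping i (i + 1) σ

/-- Odd-even hopping. -/
def H2 (L : ℕ) [NeZero L] (v : ℝ) : FockOp L :=
  (v : ℂ) • ∑ i ∈ evenSites L, ∑ σ : Fin 2, hopping (i - 1) i σ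

/-- On-site interaction. -/
def H3 (L : ℕ) [NeZero L] (u : ℝ) : FockOp L :=
  (u : ℂ) • ∑ i ∈ evenSites L,
    (number i 0 * number i 1 + number (i + 1) 0 * number (i + 1) 1)

/-- The evolution operator `e^{-itH}`. -/
def evolve {L : ℕ} [NeZero L] (H : FockOp L) (t : ℝ) : FockOp L :=
  NormedSpace.exp (-(Complex.I * (t : ℂ)) • H)

/-- The Strang (second-order Suzuki) formula
`e^{-itH_1/2} ⋯ e^{-itH_Γ/2} e^{-itH_Γ/2} ⋯ e^{-itH_1/2}` for the list of terms `H_1, …, H_Γ`. -/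
def strang {L : ℕ} [NeZero L] (Hs : List (FockOp L)) (t : ℝ) : FockOp L :=
  (Hs.map fun H => evolve H (t / 2)).prod * (Hs.reverse.map fun H => evolve H (t / 2)).prod

end FermiHubbard

end

/-!
The error of the Strang formula is controlled by nested commutators, and those of the Fermi-Hubbard
terms are sums over the sites of local operators whose norms are computed from the canonical
anticommutation relations.

For skew-adjoint `A`, `B` the product `e^{tA} e^{tB} e^{tA}` solves the differential equation of
`e^{t(A + B + A)}` up to a defect which consists of the second order Taylor remainders of two
Heisenberg evolutions. Gronwall's argument is trivial for unitary flows, and gives the error `t³/6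
(‖[B,[B,A]]‖ + ‖[A,[A,B]]‖)` (`norm_exp_mul_exp_mul_exp_sub_le`). Applied twice, it yields the
bound for three terms.

The even-odd and the odd-even bonds are the orbits of two fixed point free involutions `τ₁`, `τ₂`
of the sites, and the hoppings are `H₁ = v T₁`, `H₂ = v T₂` with `Tₐ = ∑ c_{τₐ(i)σ}† c_{iσ}`, while
`H₃ = u D` with `D` the on-site interaction. As `p, q ↦ c_p† c_q` represents matrix units, and `[D,
c_{iσ}† c_{jσ}] = (n_{iσ'} - n_{jσ'}) c_{iσ}† c_{jσ}` for the opposite spin `σ'`, all the nested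
commutators are explicit. A conjugated involution is again an involution, so that `[T₁,[T₁,T₂]] = 2
T₂ - 2 T_{τ₁τ₂τ₁}` has norm at most `4L`. The other commutators are bounded term by term, since
hoppings, currents and differences of number operators are contractions (they satisfy `x x* x =
x`), with one exception.

The exception is `[T₂,[D,T₁]]`, where counting terms gives `4L`. The constant in the theorem allows
`4L` for the sum of this commutator and `[D,[T₂,T₁]]`, which already takes `2L`. Grouping the terms
by sites gives operators `X` on three sites `i`, `j`, `k`, namely the commutators of the hopping
`B` along `jk` with `[D, A]`, for the hopping `A` along `ij`. Up to a constant and a sum of number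
operators that commutes with the hoppings, `D` is a quarter of the sum of the site parities `Q`,
and `X = ((Qᵢ - Qⱼ) B A - (Qᵢ + Qⱼ) A B) / 2`. The operators `Qᵢ ± Qⱼ` have orthogonal supports and
are intertwined by `A` and `B`, and on the support of `Qᵢ + Qⱼ` one has `A³ = 4 A` and `A B² A =
A²`. Therefore `X³ = 4 X`, and `‖X‖ ≤ 2` (`IsCAR.norm_three_site_le`).

On a chain of two sites `T₁ = T₂`. Then `[D,[T₂,T₁]]` vanishes, and the bound `4L` suffices.
-/

/-! ### The Strang formula for two terms -/

section Strang

open NormedSpace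

variable {R : Type*} [CStarAlgebra R]

/-- An estimate for a curve in a Banach space from a bound on its speed. -/
theorem norm_le_of_hasDerivAt_of_norm_deriv_le {E : Type*} [NormedAddCommGroup E]
    [NormedSpace ℝ E] {f f' : ℝ → E} {g g' : ℝ → ℝ} (hf : ∀ x, HasDerivAt f (f' x) x)
    (hg : ∀ x, HasDerivAt g (g' x) x) (h0 : ‖f 0‖ ≤ g 0) (hle : ∀ x, 0 ≤ x → ‖f' x‖ ≤ g' x)
    {t : ℝ} (ht : 0 ≤ t) : ‖f t‖ ≤ g t :=
  image_norm_le_of_norm_deriv_right_le_deriv_boundary (a := 0) (b := t)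
    (fun x _ => (hf x).continuousAt.continuousWithinAt)
    (fun x _ => (hf x).hasDerivWithinAt) h0 hg (fun x hx => hle x hx.1) ⟨ht, le_rfl⟩

theorem exp_smul_mul_exp_smul_neg (A : R) (t : ℝ) : exp (t • A) * exp (t • -A) = 1 := by
  let _ : NormedAlgebra ℚ R := .restrictScalars ℚ ℂ R
  rw [smul_neg, ← exp_add_of_commute (Commute.neg_right (Commute.refl _)), add_neg_cancel, exp_zero]

theorem exp_smul_neg_mul_exp_smul (A : R) (t : ℝ) : exp (t • -A) * exp (t • A) = 1 := by
  simpa using exp_smul_mul_exp_smul_neg (-A) t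

theorem exp_smul_mem_unitary {A : R} (hA : A ∈ skewAdjoint R) (t : ℝ) :
    exp (t • A) ∈ unitary R := by
  let _ : NormedAlgebra ℚ R := .restrictScalars ℚ ℂ R
  exact exp_mem_unitary_of_mem_skewAdjoint (skewAdjoint.smul_mem t hA)

theorem norm_exp_smul_mul {A : R} (hA : A ∈ skewAdjoint R) (t : ℝ) (X : R) :
    ‖exp (t • A) * X‖ = ‖X‖ :=
  CStarRing.norm_mem_unitary_mul X (exp_smul_mem_unitary hA t)

theorem norm_mul_exp_smul {A : R} (hA : A ∈ skewAdjoint R) (t : ℝ) (X : R) :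
    ‖X * exp (t • A)‖ = ‖X‖ :=
  CStarRing.norm_mul_mem_unitary X (exp_smul_mem_unitary hA t)

theorem hasDerivAt_exp_conj (A X : R) (t : ℝ) :
    HasDerivAt (fun s : ℝ => exp (s • A) * X * exp (s • -A))
      (exp (t • A) * ⁅A, X⁆ * exp (t • -A)) t := by
  have h := ((hasDerivAt_exp_smul_const A t).mul_const X).mul (hasDerivAt_exp_smul_const' (-A) t)
  refine h.congr_deriv ?_
  rw [Ring.lie_def]
  noncomm_ring

/-- First order Taylor estimate for the Heisenberg evolution `e^{tA} X e^{-tA}`. -/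
theorem norm_exp_conj_sub_le {A : R} (hA : A ∈ skewAdjoint R) (X : R) {t : ℝ} (ht : 0 ≤ t) :
    ‖exp (t • A) * X * exp (t • -A) - X‖ ≤ t * ‖⁅A, X⁆‖ := by
  refine norm_le_of_hasDerivAt_of_norm_deriv_le (g := fun t => t * ‖⁅A, X⁆‖)
    (fun x => (hasDerivAt_exp_conj A X x).sub_const X)
    (fun x => (hasDerivAt_id x).mul_const ‖⁅A, X⁆‖) (by simp) (fun x _ => ?_) ht
  rw [norm_mul_exp_smul (neg_mem hA), norm_exp_smul_mul hA, one_mul]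

/-- Second order Taylor estimate for the Heisenberg evolution `e^{tA} X e^{-tA}`. -/
theorem norm_exp_conj_sub_sub_le {A : R} (hA : A ∈ skewAdjoint R) (X : R) {t : ℝ} (ht : 0 ≤ t) :
    ‖exp (t • A) * X * exp (t • -A) - X - t • ⁅A, X⁆‖ ≤ t ^ 2 / 2 * ‖⁅A, ⁅A, X⁆⁆‖ := by
  refine norm_le_of_hasDerivAt_of_norm_deriv_le (g := fun t => t ^ 2 / 2 * ‖⁅A, ⁅A, X⁆⁆‖)
    (g' := fun t => t * ‖⁅A, ⁅A, X⁆⁆‖)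
    (fun x => ((hasDerivAt_exp_conj A X x).sub_const X).sub
      ((hasDerivAt_id x).smul_const ⁅A, X⁆))
    (fun x => ?_) (by simp) (fun x hx => ?_) ht
  · have := ((hasDerivAt_pow 2 x).div_const 2).mul_const ‖⁅A, ⁅A, X⁆⁆‖
    exact this.congr_deriv (by simp)
  · rw [one_smul]
    exact norm_exp_conj_sub_le hA ⁅A, X⁆ hx

/-- The error of the symmetric product `e^{tA} e^{tB} e^{tA}` as an approximation of
`e^{t(A + B + A)}`. The first order commutators in the defect of the differential equation cancel
by symmetry, which leaves the second order Taylor remainders of two Heisenberg evolutions. -/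
theorem norm_exp_mul_exp_mul_exp_sub_le {A B : R} (hA : A ∈ skewAdjoint R)
    (hB : B ∈ skewAdjoint R) {t : ℝ} (ht : 0 ≤ t) :
    ‖exp (t • A) * exp (t • B) * exp (t • A) - exp (t • (A + B + A))‖
      ≤ t ^ 3 / 6 * (‖⁅B, ⁅B, A⁆⁆‖ + ‖⁅A, ⁅A, B⁆⁆‖) := by
  set C := A + B + A with hCdef
  have hC : C ∈ skewAdjoint R := add_mem (add_mem hA hB) hA
  set K := ‖⁅B, ⁅B, A⁆⁆‖ + ‖⁅A, ⁅A, B⁆⁆‖ with hK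
  have key : ‖exp (t • -C) * (exp (t • A) * exp (t • B) * exp (t • A)) - 1‖ ≤ t ^ 3 / 6 * K := by
    refine norm_le_of_hasDerivAt_of_norm_deriv_le (g := fun t => t ^ 3 / 6 * K)
      (g' := fun t => t ^ 2 / 2 * K)
      (fun x => ((hasDerivAt_exp_smul_const (-C) x).mul
        (((hasDerivAt_exp_smul_const' A x).mul (hasDerivAt_exp_smul_const' B x)).mul
          (hasDerivAt_exp_smul_const A x))).sub_const 1)
      (fun x => ?_) (by simp) (fun x hx => ?_) ht
    · have := ((hasDerivAt_pow 3 x).div_const 6).mul_const K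
      exact this.congr_deriv (by push_cast; ring)
    · have hcomm : A * exp (x • A) = exp (x • A) * A :=
        (((Commute.refl A).smul_right x).exp_right).eq
      have e1 := exp_smul_mul_exp_smul_neg A x
      have e2 := exp_smul_neg_mul_exp_smul B x
      set G := (exp (x • B) * A * exp (x • -B) - A - x • ⁅B, A⁆)
        - (exp (x • -A) * B * exp (x • - -A) - B - x • ⁅-A, B⁆) with hG
      have hGle : ‖G‖ ≤ x ^ 2 / 2 * K := by
        refine (norm_sub_le _ _).trans ?_
        rw [hK, mul_add]
        refine add_le_add (norm_exp_conj_sub_sub_le hB A hx) ?_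
        refine (norm_exp_conj_sub_sub_le (neg_mem hA) B hx).trans_eq ?_
        have : ⁅-A, ⁅-A, B⁆⁆ = ⁅A, ⁅A, B⁆⁆ := by
          simp only [Ring.lie_def]
          noncomm_ring
        rw [this]
      have hG' : G = exp (x • B) * A * exp (x • -B) - A
          - (exp (x • -A) * B * exp (x • A) - B) := by
        have : ⁅-A, B⁆ = ⁅B, A⁆ := by
          simp only [Ring.lie_def]
          noncomm_ring
        rw [hG, this, neg_neg]
        abel
      have hid : exp (x • -C) * -C * (exp (x • A) * exp (x • B) * exp (x • A))
          + exp (x • -C) * ((A * exp (x • A) * exp (x • B) + exp (x • A) * (B * exp (x • B)))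
              * exp (x • A) + exp (x • A) * exp (x • B) * (exp (x • A) * A))
          = exp (x • -C) * (exp (x • A) * (G * (exp (x • B) * exp (x • A)))) := by
        rw [mul_assoc _ (-C), ← mul_add]
        congr 1
        rw [hG', ← hcomm]
        have : exp (x • A) * ((exp (x • B) * A * exp (x • -B) - A
              - (exp (x • -A) * B * exp (x • A) - B)) * (exp (x • B) * exp (x • A)))
            = exp (x • A) * exp (x • B) * A * (exp (x • -B) * exp (x • B)) * exp (x • A)
              - exp (x • A) * A * exp (x • B) * exp (x • A)
              - (exp (x • A) * exp (x • -A)) * B * exp (x • A) * exp (x • B) * exp (x • A)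
              + exp (x • A) * B * exp (x • B) * exp (x • A) := by
          noncomm_ring
        rw [this, e1, e2, ← hcomm, hCdef]
        noncomm_ring
      simp only [Pi.mul_apply]
      rw [hid, norm_exp_smul_mul (neg_mem hC), norm_exp_smul_mul hA, ← mul_assoc,
        norm_mul_exp_smul hA, norm_mul_exp_smul hB]
      exact hGle
  calc _ = ‖exp (t • C) * (exp (t • -C) * (exp (t • A) * exp (t • B) * exp (t • A)) - 1)‖ := by
        rw [mul_sub, ← mul_assoc, exp_smul_mul_exp_smul_neg, one_mul, mul_one]
    _ ≤ _ := by rwa [norm_exp_smul_mul hC]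

/-- The error of the symmetric product for three terms, by two applications of the case of two
terms. -/
theorem norm_exp_mul_five_sub_le {A B C : R} (hA : A ∈ skewAdjoint R) (hB : B ∈ skewAdjoint R)
    (hC : C ∈ skewAdjoint R) {t : ℝ} (ht : 0 ≤ t) :
    ‖exp (t • A) * (exp (t • B) * exp (t • C) * exp (t • B)) * exp (t • A)
        - exp (t • (A + (B + C + B) + A))‖
      ≤ t ^ 3 / 6 * (‖⁅B + C + B, ⁅B + C + B, A⁆⁆‖ + ‖⁅A, ⁅A, B + C + B⁆⁆‖
        + (‖⁅C, ⁅C, B⁆⁆‖ + ‖⁅B, ⁅B, C⁆⁆‖)) := by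
  have h1 := norm_exp_mul_exp_mul_exp_sub_le hA (add_mem (add_mem hB hC) hB) ht
  have h2 := norm_exp_mul_exp_mul_exp_sub_le hB hC ht
  rw [← norm_exp_smul_mul hA, ← norm_mul_exp_smul hA t (_ * _)] at h2
  calc _ = ‖(exp (t • A) * exp (t • (B + C + B)) * exp (t • A)
          - exp (t • (A + (B + C + B) + A)))
        + exp (t • A) * (exp (t • B) * exp (t • C) * exp (t • B) - exp (t • (B + C + B)))
          * exp (t • A)‖ := by
        congr 1
        noncomm_ring
    _ ≤ _ := (norm_add_le _ _).trans (by rw [mul_add (t ^ 3 / 6)]; exact add_le_add h1 h2)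

end Strang

/-! ### Canonical anticommutation relations and hopping operators -/

section CAR

/-- The canonical anticommutation relations for a family of annihilation operators. -/
structure IsCAR {ι R : Type*} [DecidableEq ι] [Ring R] [StarRing R] (c : ι → R) : Prop where
  anticomm : ∀ p q, c p * c q + c q * c p = 0
  anticomm_star : ∀ p q, c p * star (c q) + star (c q) * c p = if p = q then 1 else 0

/-- The one-body matrix unit `c_p† c_q`. -/
def matrixUnit {ι R : Type*} [Mul R] [Star R] (c : ι → R) (p q : ι) : R := star (c p) * c q

/-- The symmetric hopping operator `c_p† c_q + c_q† c_p`. -/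
def hop {ι R : Type*} [Ring R] [Star R] (c : ι → R) (p q : ι) : R :=
  matrixUnit c p q + matrixUnit c q p

/-- The antisymmetric hopping operator `c_p† c_q - c_q† c_p`. -/
def curr {ι R : Type*} [Ring R] [Star R] (c : ι → R) (p q : ι) : R :=
  matrixUnit c p q - matrixUnit c q p

/-- The parity operator `1 - 2 c_p† c_p` of a mode. -/
def modeParity {ι R : Type*} [Ring R] [Star R] (c : ι → R) (p : ι) : R :=
  1 - 2 * matrixUnit c p p

variable {ι R : Type*} [CStarAlgebra R] {c : ι → R} {p q r s : ι}

@[simp] theorem star_matrixUnit : star (matrixUnit c p q) = matrixUnit c q p := by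
  simp [matrixUnit]

@[simp] theorem star_hop : star (hop c p q) = hop c p q := by
  simp [hop, add_comm]

@[simp] theorem star_curr : star (curr c p q) = -curr c p q := by
  simp [curr]

@[simp] theorem curr_self : curr c p p = 0 := sub_self _

theorem hop_comm (c : ι → R) (p q : ι) : hop c p q = hop c q p := add_comm _ _

theorem curr_swap (c : ι → R) (p q : ι) : curr c p q = -curr c q p := (neg_sub _ _).symm

theorem eq_of_two_mul_eq {x y : R} (h : 2 * x = 2 * y) : x = y := by
  have h' : (2 : ℂ) • x = (2 : ℂ) • y := by
    simpa only [two_smul, two_mul] using h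
  exact smul_right_injective R (two_ne_zero (α := ℂ)) h'

/-- An element with `x x* x = k² x`, which is `k` times a partial isometry, has norm at most `k`. -/
theorem norm_le_of_mul_star_mul {x : R} {k : ℝ} (hk : 0 ≤ k)
    (h : x * star x * x = (k ^ 2) • x) : ‖x‖ ≤ k := by
  have h1 : ‖star x * x * (star x * x)‖ = ‖star x * x‖ * ‖star x * x‖ := by
    have := CStarRing.norm_star_mul_self (x := star x * x)
    rwa [star_mul, star_star] at this
  have h2 : star x * x * (star x * x) = (k ^ 2) • (star x * x) := by
    rw [← mul_smul_comm, ← h]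
    noncomm_ring
  rw [h2, norm_smul, CStarRing.norm_star_mul_self, Real.norm_of_nonneg (sq_nonneg k)] at h1
  rcases eq_or_ne ‖x‖ 0 with h0 | h0
  · rwa [h0]
  · have h3 : k ^ 2 = ‖x‖ * ‖x‖ := mul_right_cancel₀ (mul_ne_zero h0 h0) h1
    nlinarith [norm_nonneg x]

namespace IsCAR

variable [DecidableEq ι] (hc : IsCAR c)
include hc

theorem mul_self (p : ι) : c p * c p = 0 := by
  refine eq_of_two_mul_eq ?_
  rw [two_mul, hc.anticomm, mul_zero]

theorem star_anticomm (p q : ι) : star (c p) * star (c q) + star (c q) * star (c p) = 0 := by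
  have := congrArg star (hc.anticomm q p)
  simpa using this

/-- The matrix units span a representation of the general linear Lie algebra. -/
theorem matrixUnit_lie (p q r s : ι) :
    ⁅matrixUnit c p q, matrixUnit c r s⁆
      = (if q = r then matrixUnit c p s else 0) - (if p = s then matrixUnit c r q else 0) := by
  have h1 := hc.anticomm_star q r
  have h2 := hc.anticomm_star s p
  have h3 := hc.anticomm q s
  have h4 := hc.star_anticomm p r
  have e1 : (if q = r then matrixUnit c p s else 0)
      = star (c p) * (if q = r then 1 else 0) * c s := by split_ifs <;> simp [matrixUnit]
  have e2 : (if p = s then matrixUnit c r q else 0)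
      = star (c r) * (if s = p then 1 else 0) * c q := by
    simp only [eq_comm (a := p)]
    split_ifs <;> simp [matrixUnit]
  rw [e1, e2, ← h1, ← h2, Ring.lie_def, matrixUnit, matrixUnit]
  linear_combination (norm := noncomm_ring)
    star (c r) * star (c p) * h3 - h4 * c q * c s

theorem number_mul_matrixUnit (p q : ι) :
    matrixUnit c p p * matrixUnit c p q = matrixUnit c p q := by
  have h1 := hc.anticomm_star p p
  have h2 := hc.star_anticomm p p
  rw [if_pos rfl] at h1
  have h3 : star (c p) * star (c p) = 0 := by simpa using congrArg star (hc.mul_self p)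
  simp only [matrixUnit]
  linear_combination (norm := noncomm_ring) star (c p) * h1 * c q - h3 * c p * c q

theorem number_mul_matrixUnit_of_ne (h : p ≠ q) :
    matrixUnit c q q * matrixUnit c p q = 0 := by
  have h1 := hc.anticomm_star q p
  rw [if_neg h.symm] at h1
  simp only [matrixUnit]
  linear_combination (norm := noncomm_ring) star (c q) * h1 * c q
    - star (c q) * star (c p) * hc.mul_self q

theorem matrixUnit_mul_number (p q : ι) :
    matrixUnit c p q * matrixUnit c q q = matrixUnit c p q := by
  simpa using congrArg star (hc.number_mul_matrixUnit q p)

theorem matrixUnit_mul_number_of_ne (h : p ≠ q) :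
    matrixUnit c p q * matrixUnit c p p = 0 := by
  simpa using congrArg star (hc.number_mul_matrixUnit_of_ne h.symm)

theorem matrixUnit_mul_self (h : p ≠ q) : matrixUnit c p q * matrixUnit c p q = 0 := by
  linear_combination (norm := noncomm_ring)
    matrixUnit c p q * hc.number_mul_matrixUnit_of_ne h
      - hc.matrixUnit_mul_number p q * matrixUnit c p q

theorem commute_matrixUnit (hqr : q ≠ r) (hps : p ≠ s) :
    Commute (matrixUnit c p q) (matrixUnit c r s) := by
  have := hc.matrixUnit_lie p q r s
  rwa [if_neg hqr, if_neg hps, sub_zero, Ring.lie_def, sub_eq_zero] at this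

theorem commute_number (p q : ι) : Commute (matrixUnit c p p) (matrixUnit c q q) := by
  rcases eq_or_ne p q with rfl | h
  · exact Commute.refl _
  · exact hc.commute_matrixUnit h h

theorem matrixUnit_mul_swap (h : p ≠ q) :
    matrixUnit c p q * matrixUnit c q p
      = matrixUnit c p p - matrixUnit c p p * matrixUnit c q q := by
  have h1 := hc.anticomm_star q q
  have h2 := hc.anticomm q p
  have h3 := hc.anticomm_star p q
  rw [if_pos rfl] at h1
  rw [if_neg h] at h3
  simp only [matrixUnit]
  linear_combination (norm := noncomm_ring) star (c p) * h1 * c p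
    - star (c p) * star (c q) * h2 + star (c p) * h3 * c q

/-- The square of a hopping operator projects on the states with one particle in its two modes. -/
theorem two_mul_hop_mul_self (h : p ≠ q) :
    2 * (hop c p q * hop c p q) = 1 - modeParity c p * modeParity c q := by
  have h1 := hc.matrixUnit_mul_swap h
  have h2 := hc.matrixUnit_mul_swap h.symm
  have h3 := hc.matrixUnit_mul_self h
  have h4 := hc.matrixUnit_mul_self h.symm
  have h5 := (hc.commute_number p q).eq
  simp only [hop, modeParity]
  linear_combination (norm := noncomm_ring) 2 * h1 + 2 * h2 + 2 * h3 + 2 * h4 + 2 * h5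

theorem modeParity_mul_self (p : ι) : modeParity c p * modeParity c p = 1 := by
  have := hc.number_mul_matrixUnit p p
  simp only [modeParity]
  linear_combination (norm := noncomm_ring) 4 * this

theorem commute_modeParity (p q : ι) : Commute (modeParity c p) (modeParity c q) :=
  (Commute.one_left _).sub_left (((Commute.ofNat_left 2 _)).mul_left
    ((Commute.one_right _).sub_right ((Commute.ofNat_right _ 2).mul_right
      (hc.commute_number p q))))

theorem curr_eq (h : p ≠ q) : curr c p q = -(modeParity c p * hop c p q) := by
  have h1 := hc.number_mul_matrixUnit p q
  have h2 := hc.number_mul_matrixUnit_of_ne h.symm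
  simp only [modeParity, hop, curr]
  linear_combination (norm := noncomm_ring) (-2 : ℤ) • h1 - 2 * h2

theorem modeParity_mul_hop (h : p ≠ q) :
    modeParity c p * hop c p q = -(hop c p q * modeParity c p) := by
  have h1 := hc.number_mul_matrixUnit p q
  have h2 := hc.number_mul_matrixUnit_of_ne h.symm
  have h3 := hc.matrixUnit_mul_number q p
  have h4 := hc.matrixUnit_mul_number_of_ne h
  simp only [modeParity, hop]
  linear_combination (norm := noncomm_ring) (-2 : ℤ) • (h1 + h2 + h3 + h4)

theorem commute_modeParity_hop (hp : r ≠ p) (hq : r ≠ q) :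
    Commute (modeParity c r) (hop c p q) :=
  (Commute.one_left _).sub_left ((Commute.ofNat_left 2 _).mul_left
    ((hc.commute_matrixUnit hp hq).add_right (hc.commute_matrixUnit hq hp)))

theorem hop_mul_hop_mul_hop (h : p ≠ q) : hop c p q * hop c p q * hop c p q = hop c p q := by
  have h1 := hc.two_mul_hop_mul_self h
  have h2 := hc.curr_eq h
  have h3 := hc.curr_eq h.symm
  have h4 := hc.modeParity_mul_hop h.symm
  have h5 := hc.modeParity_mul_self p
  rw [curr_swap, hop_comm c q p] at h3
  rw [hop_comm c q p] at h4
  refine eq_of_two_mul_eq ?_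
  linear_combination (norm := noncomm_ring) h1 * hop c p q
    - modeParity c p * h3 - modeParity c p * h2 + h5 * hop c p q

theorem curr_mul_curr_mul_curr (h : p ≠ q) :
    curr c p q * curr c p q * curr c p q = -curr c p q := by
  have h1 := hc.hop_mul_hop_mul_hop h
  have h2 := hc.modeParity_mul_hop h
  have h3 := hc.modeParity_mul_self p
  rw [hc.curr_eq h]
  linear_combination (norm := noncomm_ring)
    -(modeParity c p * hop c p q * h2 * (modeParity c p * hop c p q))
      + modeParity c p * hop c p q * hop c p q * h3 * hop c p q + modeParity c p * h1

theorem norm_hop_le (h : p ≠ q) : ‖hop c p q‖ ≤ 1 :=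
  norm_le_of_mul_star_mul zero_le_one (by rw [star_hop, hc.hop_mul_hop_mul_hop h]; simp)

theorem norm_curr_le (p q : ι) : ‖curr c p q‖ ≤ 1 := by
  rcases eq_or_ne p q with rfl | h
  · simp
  · exact norm_le_of_mul_star_mul zero_le_one
      (by rw [star_curr, mul_neg, neg_mul, hc.curr_mul_curr_mul_curr h]; simp)

theorem norm_number_sub_number_le (p q : ι) :
    ‖matrixUnit c p p - matrixUnit c q q‖ ≤ 1 := by
  refine norm_le_of_mul_star_mul zero_le_one ?_
  have h1 := hc.number_mul_matrixUnit p p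
  have h2 := hc.number_mul_matrixUnit q q
  have h3 := (hc.commute_number p q).eq
  rw [star_sub, star_matrixUnit, star_matrixUnit]
  generalize matrixUnit c p p = n at *
  generalize matrixUnit c q q = m at *
  have hd : (n - m) * (n - m) = n + m - 2 * (n * m) := by
    linear_combination (norm := noncomm_ring) h1 + h2 + h3
  rw [one_pow, one_smul]
  linear_combination (norm := noncomm_ring) hd * (n - m) + h1 - h2 - h3 + 2 * n * h3
    - 2 * h1 * m + 2 * n * h2

end IsCAR

end CAR

/-! ### The three-site operator -/

section ThreeSite

/-- The algebraic core of the three-site bound: `A` and `B` intertwine two mutually orthogonal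
operators `P`, `M`, so that the powers of `M B A - P A B` reduce to words in which the
two relations for `A` and `B` on the range of `P` apply. -/
theorem cube_eq_of_intertwine {R : Type*} [Ring R] {A B P M : R}
    (hBP : B * P = M * B) (hBM : B * M = P * B) (hAP : A * P = -(P * A)) (hAM : A * M = -(M * A))
    (hPM : P * M = 0) (hMP : M * P = 0) (hP : P * P * P = 4 * P) (hM : M * M * M = 4 * M)
    (h1 : A * B * B * A * (P * P) = A * A * (P * P))
    (h2 : A * A * A * (P * P) = 4 * (A * (P * P))) :
    (M * B * A - P * A * B) * (M * B * A - P * A * B) * (M * B * A - P * A * B)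
      = 16 * (M * B * A - P * A * B) := by
  have hMBAM : M * B * A * M = 0 := by
    linear_combination (norm := noncomm_ring) M * B * hAM - M * hBM * A - hMP * B * A
  have hPABP : P * A * B * P = 0 := by
    linear_combination (norm := noncomm_ring) P * A * hBP + P * hAM * B - hPM * A * B
  have hAPP : A * (P * P) = P * P * A := by
    linear_combination (norm := noncomm_ring) hAP * P - P * hAP
  have hBPP : B * (P * P) = M * M * B := by
    linear_combination (norm := noncomm_ring) hBP * P + M * hBP
  have hBMM : B * (M * M) = P * P * B := by
    linear_combination (norm := noncomm_ring) hBM * M + P * hBM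
  have hAMM : A * (M * M) = M * M * A := by
    linear_combination (norm := noncomm_ring) hAM * M - M * hAM
  have hsq : (M * B * A - P * A * B) * (M * B * A - P * A * B)
      = M * M * B * A * A * B + P * P * A * B * B * A := by
    linear_combination (norm := noncomm_ring) hMBAM * B * A + hPABP * A * B
      - M * B * hAP * A * B + M * hBP * A * A * B - P * A * hBM * B * A - P * hAP * B * B * A
  have hBB : B * B * (P * P) = P * P * B * B := by
    linear_combination (norm := noncomm_ring) B * hBPP + hBMM * B
  have hcomm : A * B * B * A * (P * P) = P * P * A * B * B * A := by
    linear_combination (norm := noncomm_ring) A * B * B * hAPP + A * hBB * A + hAPP * B * B * A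
  have hfirst : M * B * A * (P * P * A * B * B * A) = 16 * (M * B * A) := by
    linear_combination (norm := noncomm_ring) M * B * A * h1 - M * B * A * hcomm + M * B * h2
      + 4 * M * B * hAPP + 4 * M * hBPP * A + 4 * hM * B * A
  have hsecond : P * A * B * (M * M * B * A * A * B) = 16 * (P * A * B) := by
    linear_combination (norm := noncomm_ring) P * A * hBMM * B * A * A * B
      - P * A * hBB * A * A * B - P * A * B * B * hAPP * A * B + P * h1 * A * B
      - P * A * A * hAPP * B + P * h2 * B + 4 * P * hAPP * B + 4 * hP * A * B
  rw [mul_assoc (M * B * A - P * A * B), hsq]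
  linear_combination (norm := noncomm_ring) hfirst - hsecond + hMBAM * M * B * A * A * B
    - hPABP * P * A * B * B * A

/-- The relations between the operators of one spin species on three sites `i`, `j`, `k`:
`z` and `w` are the parities of `i` and `j`, and `a` and `b` the hoppings `ij` and `jk`. -/
structure HopChain {R : Type*} [Ring R] (z w a b : R) : Prop where
  z_mul_z : z * z = 1
  w_mul_w : w * w = 1
  z_mul_w : z * w = w * z
  two_a_sq : 2 * (a * a) = 1 - z * w
  z_mul_a : z * a = -(a * z)
  w_mul_a : w * a = -(a * w)
  z_mul_b : z * b = b * z
  w_mul_b : w * b = -(b * w)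
  a_cube : a * a * a = a
  b_sq_a : b * b * a + a * (b * b) = a
  a_mul_b_mul_a : a * b * a = 0

namespace HopChain

variable {R : Type*} [Ring R] {z w a b z' w' a' b' : R}

theorem a_mul_z_mul_w (h : HopChain z w a b) : a * (z * w) = -a := by
  linear_combination (norm := noncomm_ring) (-2 : ℤ) • h.a_cube + a * h.two_a_sq

theorem w_mul_a_eq (h : HopChain z w a b) : w * a = -(z * a) := by
  linear_combination (norm := noncomm_ring) z * z * h.w_mul_a - z * h.z_mul_a * w
    + z * h.a_mul_z_mul_w - h.z_mul_z * w * a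

set_option linter.unusedSimpArgs false in
/-- The cubic relation `X³ = 4 X` of the three-site operator, for `Y = 2 X`. The primed operators
belong to the other spin species. In terms of the site parities `Q₁ = z z'`, `Q₂ = w w'` and the
total hoppings `A = a + a'`, `B = b + b'`, one has `Y = (Q₁ - Q₂) B A - (Q₁ + Q₂) A B`. -/
theorem cube_eq (h : HopChain z w a b) (h' : HopChain z' w' a' b')
    (hcomm : ∀ x ∈ ({z, w, a, b} : Set R), ∀ y ∈ ({z', w', a', b'} : Set R), Commute x y)
    {Y : R} (hY : Y = 2 * (w' * b' * (z * a)) + 2 * (w * b * (z' * a'))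
      - (w' - z') * (w * (a * b + b * a)) - (w - z) * (w' * (a' * b' + b' * a'))) :
    Y * Y * Y = 16 * Y := by
  simp only [Set.mem_insert_iff, Set.mem_singleton_iff, forall_eq_or_imp, forall_eq] at hcomm
  obtain ⟨⟨zz, zw, za, zb⟩, ⟨wz, ww, wa, wb⟩, ⟨az, aw, aa, ab⟩, ⟨bz, bw, ba, bb⟩⟩ := hcomm
  have assoc {x y r : R} (e : x * y = r) (c : R) : x * (y * c) = r * c := by
    rw [← mul_assoc, e]
  have a_mul_w {z w a b : R} (h : HopChain z w a b) : a * w = -(a * z) := by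
    rw [← neg_inj, ← h.w_mul_a, h.w_mul_a_eq, h.z_mul_a]
  have w_mul_a {z w a b : R} (h : HopChain z w a b) : w * a = a * z := by
    rw [h.w_mul_a, a_mul_w h, neg_neg]
  have b_mul_b_mul_a {z w a b : R} (h : HopChain z w a b) : b * (b * a) = a - a * (b * b) := by
    rw [eq_sub_iff_add_eq, ← mul_assoc, h.b_sq_a]
  have hAP : (a + a') * ((z * z' + w * w') * (z * z' + w * w'))
      = 4 * (a * a' * a' + a * a * a') := by
    have e1 : (z * z' + w * w') * (z * z' + w * w') = 2 * (1 + z * w * (z' * w')) := by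
      simp only [mul_add, add_mul, mul_assoc, zz.symm.left_comm, wz.symm.left_comm,
        zw.symm.left_comm, ww.symm.left_comm, h.z_mul_z, assoc h.z_mul_z, h'.z_mul_z,
        h.w_mul_w, assoc h.w_mul_w, h'.w_mul_w, ← h.z_mul_w, assoc h.z_mul_w.symm, ← h'.z_mul_w]
      noncomm_ring
    have e2 := h.two_a_sq
    have e3 := h'.two_a_sq
    have e4 := h.a_mul_z_mul_w
    have e5 := h'.a_mul_z_mul_w
    have e6 : a' * (z * w) = z * w * a' := ((za.mul_left wa).symm).eq
    rw [e1]
    linear_combination (norm := noncomm_ring) 2 * e4 * (z' * w') + 2 * e6 * (z' * w')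
      + 2 * z * w * e5 - 2 * a * e3 - 2 * e2 * a'
  have cross {x y : R} (e : Commute x y) : y * x = x * y := e.eq.symm
  have cross' {x y : R} (e : Commute x y) (c : R) : y * (x * c) = x * (y * c) :=
    e.symm.left_comm c
  -- All the intertwining relations are settled by the same rewriting system: primed operators are
  -- moved to the right, and each species is normalised by its own relations.
  have key : Y = (z * z' - w * w') * (b + b') * (a + a') - (z * z' + w * w') * (a + a') * (b + b')
      ∧ (b + b') * (z * z' + w * w') = (z * z' - w * w') * (b + b')
      ∧ (b + b') * (z * z' - w * w') = (z * z' + w * w') * (b + b')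
      ∧ (a + a') * (z * z' + w * w') = -((z * z' + w * w') * (a + a'))
      ∧ (a + a') * (z * z' - w * w') = -((z * z' - w * w') * (a + a'))
      ∧ (z * z' + w * w') * (z * z' - w * w') = 0
      ∧ (z * z' - w * w') * (z * z' + w * w') = 0
      ∧ (z * z' + w * w') * (z * z' + w * w') * (z * z' + w * w') = 4 * (z * z' + w * w')
      ∧ (z * z' - w * w') * (z * z' - w * w') * (z * z' - w * w') = 4 * (z * z' - w * w') := by
    rw [hY]
    refine ⟨?_, ?_, ?_, ?_, ?_, ?_, ?_, ?_, ?_⟩ <;>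
    simp only [mul_add, add_mul, sub_mul, mul_sub, mul_assoc, neg_mul, mul_neg, one_mul,
      mul_one,
      cross zz, cross zw, cross za, cross zb, cross wz, cross ww, cross wa, cross wb,
      cross az, cross aw, cross aa, cross ab, cross bz, cross bw, cross ba, cross bb,
      cross' zz, cross' zw, cross' za, cross' zb, cross' wz, cross' ww, cross' wa, cross' wb,
      cross' az, cross' aw, cross' aa, cross' ab, cross' bz, cross' bw, cross' ba, cross' bb,
      h.z_mul_z, assoc h.z_mul_z, h.w_mul_w, assoc h.w_mul_w, h.z_mul_w, assoc h.z_mul_w,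
      h.z_mul_a, assoc h.z_mul_a, h.z_mul_b, assoc h.z_mul_b,
      h.w_mul_b, assoc h.w_mul_b, w_mul_a h, assoc (w_mul_a h), a_mul_w h, assoc (a_mul_w h),
      h'.z_mul_z, assoc h'.z_mul_z, h'.w_mul_w, assoc h'.w_mul_w, h'.z_mul_w, assoc h'.z_mul_w,
      h'.z_mul_a, assoc h'.z_mul_a, h'.z_mul_b, assoc h'.z_mul_b,
      h'.w_mul_b, assoc h'.w_mul_b, w_mul_a h', assoc (w_mul_a h'), a_mul_w h', assoc (a_mul_w h')]
    all_goals first | abel1 | noncomm_ring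
  obtain ⟨hfac, hBP, hBM, hAP', hAM, hPM, hMP, hP, hM⟩ := key
  have aaa {z w a b : R} (h : HopChain z w a b) : a * (a * a) = a := by rw [← mul_assoc, h.a_cube]
  have aba {z w a b : R} (h : HopChain z w a b) : a * (b * a) = 0 := by
    rw [← mul_assoc, h.a_mul_b_mul_a]
  have aaac {z w a b : R} (h : HopChain z w a b) (c : R) : a * (a * (a * c)) = a * c := by
    simp only [← mul_assoc, h.a_cube]
  have abac {z w a b : R} (h : HopChain z w a b) (c : R) : a * (b * (a * c)) = 0 := by
    simp only [← mul_assoc, h.a_mul_b_mul_a, zero_mul]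
  have bbac {z w a b : R} (h : HopChain z w a b) (c : R) :
      b * (b * (a * c)) = a * c - a * (b * (b * c)) := by
    rw [← mul_assoc b a, ← mul_assoc b (b * a), b_mul_b_mul_a h]
    noncomm_ring
  have four_mul_eq (W : R) : 4 * W = 4 • W := by simp
  rw [hfac]
  refine cube_eq_of_intertwine hBP hBM hAP' hAM hPM hMP hP hM ?_ ?_
  · rw [mul_assoc, mul_assoc (a + a') (a + a'), hAP, ← sub_eq_zero]
    simp only [four_mul_eq, mul_smul_comm, ← smul_sub]
    convert smul_zero (4 : ℕ)
    simp only [mul_add, add_mul, sub_mul, mul_sub, mul_assoc, mul_zero, zero_mul,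
      cross aa, cross ab, cross ba, cross bb, cross' aa, cross' ab, cross' ba, cross' bb,
      aaa h, aaa h', aaac h, aaac h', aba h, aba h', abac h, abac h', b_mul_b_mul_a h,
      b_mul_b_mul_a h', bbac h, bbac h']
    abel
  · rw [mul_assoc, mul_assoc, hAP]
    simp only [four_mul_eq, mul_smul_comm, ← smul_add, mul_add, add_mul, mul_assoc,
      cross aa, cross' aa, aaa h, aaa h', aaac h, aaac h']
    abel

end HopChain

namespace IsCAR

variable {ι R : Type*} [DecidableEq ι] [CStarAlgebra R] {c : ι → R} {p q s p' q' s' : ι}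
variable (hc : IsCAR c)
include hc

attribute [local instance] LieRing.ofAssociativeRing

theorem hop_sq_mul_hop (hpq : p ≠ q) (hqs : q ≠ s) (hps : p ≠ s) :
    hop c p q * hop c p q * hop c q s + hop c q s * (hop c p q * hop c p q) = hop c q s := by
  have h1 := hc.two_mul_hop_mul_self hpq
  have h2 := (hc.commute_modeParity_hop hpq hps).eq
  have h3 := hc.modeParity_mul_hop hqs
  refine eq_of_two_mul_eq ?_
  linear_combination (norm := noncomm_ring) h1 * hop c q s + hop c q s * h1
    - modeParity c p * h3 + h2 * modeParity c q

theorem hopChain (hpq : p ≠ q) (hqs : q ≠ s) (hps : p ≠ s) :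
    HopChain (modeParity c p) (modeParity c q) (hop c p q) (hop c q s) where
  z_mul_z := hc.modeParity_mul_self p
  w_mul_w := hc.modeParity_mul_self q
  z_mul_w := (hc.commute_modeParity p q).eq
  two_a_sq := hc.two_mul_hop_mul_self hpq
  z_mul_a := hc.modeParity_mul_hop hpq
  w_mul_a := by simpa only [hop_comm c q p] using hc.modeParity_mul_hop hpq.symm
  z_mul_b := (hc.commute_modeParity_hop hpq hps).eq
  w_mul_b := hc.modeParity_mul_hop hqs
  a_cube := hc.hop_mul_hop_mul_hop hpq
  b_sq_a := by
    simpa only [hop_comm c s q, hop_comm c q p] using hc.hop_sq_mul_hop hqs.symm hpq.symm hps.symm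
  a_mul_b_mul_a := by
    have h1 := hc.hop_sq_mul_hop hpq hqs hps
    have h2 := hc.hop_mul_hop_mul_hop hpq
    linear_combination (norm := noncomm_ring) hop c p q * h1 * hop c p q
      - h2 * hop c q s * hop c p q - hop c p q * hop c q s * h2

theorem hop_lie_curr (hpq : p ≠ q) (hqs : q ≠ s) (hps : p ≠ s) :
    ⁅hop c p q, curr c q s⁆ = hop c p s := by
  simp [hop, curr, hc.matrixUnit_lie, hpq, hqs, hps]

theorem commute_hop (h1 : p ≠ p') (h2 : p ≠ q') (h3 : q ≠ p') (h4 : q ≠ q') :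
    Commute (hop c p q) (hop c p' q') :=
  ((hc.commute_matrixUnit h3 h2).add_right (hc.commute_matrixUnit h4 h1)).add_left
    ((hc.commute_matrixUnit h1 h4).add_right (hc.commute_matrixUnit h2 h3))

theorem commute_curr (h1 : p ≠ p') (h2 : p ≠ q') (h3 : q ≠ p') (h4 : q ≠ q') :
    Commute (curr c p q) (curr c p' q') :=
  ((hc.commute_matrixUnit h3 h2).sub_right (hc.commute_matrixUnit h4 h1)).sub_left
    ((hc.commute_matrixUnit h1 h4).sub_right (hc.commute_matrixUnit h2 h3))

theorem commute_number_sub_hop (h1 : p ≠ p') (h2 : p ≠ q') (h3 : q ≠ p') (h4 : q ≠ q') :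
    Commute (matrixUnit c p p - matrixUnit c q q) (hop c p' q') :=
  ((hc.commute_matrixUnit h1 h2).add_right (hc.commute_matrixUnit h2 h1)).sub_left
    ((hc.commute_matrixUnit h3 h4).add_right (hc.commute_matrixUnit h4 h3))

/-- The three-site bound: for two spin species on three distinct sites, the commutator of a
hopping with the commutator of the on-site interaction and an adjacent hopping has norm at most
two, although it consists of four terms of norm one. -/
theorem norm_three_site_le (hpq : p ≠ q) (hqs : q ≠ s) (hps : p ≠ s)
    (hpq' : p' ≠ q') (hqs' : q' ≠ s') (hps' : p' ≠ s')
    (hdisj : ∀ x ∈ ({p, q, s} : Set ι), ∀ y ∈ ({p', q', s'} : Set ι), x ≠ y) :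
    ‖(curr c q' s' * curr c p q - (matrixUnit c p' p' - matrixUnit c q' q') * hop c p s)
      + (curr c q s * curr c p' q' - (matrixUnit c p p - matrixUnit c q q) * hop c p' s')‖ ≤ 2 := by
  simp only [Set.mem_insert_iff, Set.mem_singleton_iff, forall_eq_or_imp, forall_eq] at hdisj
  obtain ⟨⟨pp, pq, ps⟩, ⟨qp, qq, qs⟩, ⟨sp, sq, ss⟩⟩ := hdisj
  have h := hc.hopChain hpq hqs hps
  have h' := hc.hopChain hpq' hqs' hps'
  have hcomm : ∀ x ∈ ({modeParity c p, modeParity c q, hop c p q, hop c q s} : Set R),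
      ∀ y ∈ ({modeParity c p', modeParity c q', hop c p' q', hop c q' s'} : Set R),
      Commute x y := by
    simp only [Set.mem_insert_iff, Set.mem_singleton_iff, forall_eq_or_imp, forall_eq]
    exact ⟨⟨hc.commute_modeParity _ _, hc.commute_modeParity _ _,
        hc.commute_modeParity_hop pp pq, hc.commute_modeParity_hop pq ps⟩,
      ⟨hc.commute_modeParity _ _, hc.commute_modeParity _ _,
        hc.commute_modeParity_hop qp qq, hc.commute_modeParity_hop qq qs⟩,
      ⟨(hc.commute_modeParity_hop pp.symm qp.symm).symm,
        (hc.commute_modeParity_hop pq.symm qq.symm).symm,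
        hc.commute_hop pp pq qp qq, hc.commute_hop pq ps qq qs⟩,
      ⟨(hc.commute_modeParity_hop qp.symm sp.symm).symm,
        (hc.commute_modeParity_hop qq.symm sq.symm).symm,
        hc.commute_hop qp qq sp sq, hc.commute_hop qq qs sq ss⟩⟩
  have hop_eq {p q s : ι} (hpq : p ≠ q) (hqs : q ≠ s) (hps : p ≠ s) : hop c p s
      = modeParity c q * (hop c p q * hop c q s + hop c q s * hop c p q) := by
    have h1 := (hc.hopChain hpq hqs hps).w_mul_a
    rw [← hc.hop_lie_curr hpq hqs hps, hc.curr_eq hqs, Ring.lie_def]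
    linear_combination (norm := noncomm_ring) -h1 * hop c q s
  set X := (curr c q' s' * curr c p q - (matrixUnit c p' p' - matrixUnit c q' q') * hop c p s)
      + (curr c q s * curr c p' q' - (matrixUnit c p p - matrixUnit c q q) * hop c p' s') with hX
  have hstar : star X = X := by
    have c1 := (hc.commute_curr pq.symm qq.symm ps.symm qs.symm).eq
    have c2 := (hc.commute_curr qp qq sp sq).eq
    have c3 := (hc.commute_number_sub_hop pp.symm sp.symm pq.symm sq.symm).eq
    have c4 := (hc.commute_number_sub_hop pp ps qp qs).eq
    simp only [hX, star_add, star_sub, star_mul, star_curr, star_hop, star_matrixUnit,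
      neg_mul_neg, c1, c2, c3, c4]
  have hcube := h.cube_eq h' hcomm (Y := 2 * X) (by
    rw [hX, hop_eq hpq hqs hps, hop_eq hpq' hqs' hps', hc.curr_eq hpq, hc.curr_eq hqs,
      hc.curr_eq hpq', hc.curr_eq hqs']
    simp only [modeParity]
    noncomm_ring)
  refine norm_le_of_mul_star_mul zero_le_two ?_
  rw [hstar]
  have h8 : (8 : ℂ) • (X * X * X) = (8 : ℂ) • (4 : ℂ) • X := by
    simp only [← algebraMap_smul R, smul_eq_mul, map_ofNat]
    linear_combination (norm := noncomm_ring) hcube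
  have h4 := smul_right_injective R (by norm_num : (8 : ℂ) ≠ 0) h8
  rw [h4, ← Complex.coe_smul]
  norm_num

end IsCAR

end ThreeSite

/-! ### Nested commutators of hopping and interaction -/

section Lattice

attribute [local instance] LieRing.ofAssociativeRing

variable {S R : Type*} [Fintype S] [CStarAlgebra R]

/-- The hopping operator `∑ c_{τ(i)σ}† c_{iσ}` along a map `τ` of the lattice sites. For an
involution without fixed points this is the sum of the symmetric hoppings over the
bonds `{i, τ(i)}`. -/
def hopAlong (c : S × Fin 2 → R) (τ : S → S) : R :=
  ∑ i, ∑ σ, matrixUnit c (τ i, σ) (i, σ)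

/-- The on-site interaction `∑ n_{i↑} n_{i↓}`. -/
def interaction (c : S × Fin 2 → R) : R :=
  ∑ i, matrixUnit c (i, 0) (i, 0) * matrixUnit c (i, 1) (i, 1)

/-- The difference `n_{iσ} - n_{jσ}`. -/
def numberDiff (c : S × Fin 2 → R) (i j : S) (σ : Fin 2) : R :=
  matrixUnit c (i, σ) (i, σ) - matrixUnit c (j, σ) (j, σ)

omit [Fintype S] in
theorem numberDiff_swap (c : S × Fin 2 → R) (i j : S) (σ : Fin 2) :
    numberDiff c i j σ = -numberDiff c j i σ := (neg_sub _ _).symm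

theorem norm_sum_sum_le {f : S → Fin 2 → R} {C : ℝ} (h : ∀ i σ, ‖f i σ‖ ≤ C) :
    ‖∑ i, ∑ σ, f i σ‖ ≤ 2 * Fintype.card S * C := by
  refine (norm_sum_le_of_le _ fun i _ => norm_sum_le_of_le _ fun σ _ => h i σ).trans_eq ?_
  simp
  ring

theorem norm_le_of_two_mul_eq {x y : R} {C : ℝ} (h : 2 * x = y) (hy : ‖y‖ ≤ 2 * C) : ‖x‖ ≤ C := by
  have : ‖(2 : ℂ) • x‖ ≤ 2 * C := by
    rwa [two_smul, ← two_mul, h]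
  rw [norm_smul] at this
  norm_num at this
  linarith

theorem leibniz_lie_mul (x y z : R) : ⁅x, y * z⁆ = ⁅x, y⁆ * z + y * ⁅x, z⁆ := by
  simp only [Ring.lie_def]
  noncomm_ring

theorem fin_two_add_one_ne (σ : Fin 2) : σ + 1 ≠ σ := by fin_cases σ <;> decide

theorem sum_comp_involutive {τ : S → S} (hτ : Function.Involutive τ) (f : S → R) :
    ∑ i, f (τ i) = ∑ i, f i := Equiv.sum_comp hτ.toPerm f

namespace IsCAR

variable [DecidableEq S] {c : S × Fin 2 → R} (hc : IsCAR c) {τ τ₁ τ₂ : S → S}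
include hc

theorem hopAlong_lie_matrixUnit (hτ : Function.Involutive τ) (i j : S) (σ : Fin 2) :
    ⁅hopAlong c τ, matrixUnit c (i, σ) (j, σ)⁆
      = matrixUnit c (τ i, σ) (j, σ) - matrixUnit c (i, σ) (τ j, σ) := by
  have h (k : S) : τ k = j ↔ k = τ j := ⟨fun h => by rw [← h, hτ], fun h => by rw [h, hτ]⟩
  simp only [hopAlong, sum_lie, hc.matrixUnit_lie, Finset.sum_sub_distrib, Prod.mk.injEq]
  congr 1
  · simp [ite_and]
  · simp [h, ite_and]

theorem interaction_lie_matrixUnit (i j : S) (σ : Fin 2) :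
    ⁅interaction c, matrixUnit c (i, σ) (j, σ)⁆
      = numberDiff c i j (σ + 1) * matrixUnit c (i, σ) (j, σ) := by
  have h (k : S) : matrixUnit c (k, 0) (k, 0) * matrixUnit c (k, 1) (k, 1)
      = matrixUnit c (k, σ + 1) (k, σ + 1) * matrixUnit c (k, σ) (k, σ) := by
    fin_cases σ
    · exact (hc.commute_number _ _).eq
    · rfl
  have hne : σ + 1 ≠ σ := fin_two_add_one_ne σ
  have h' (k : S) : ⁅matrixUnit c (k, σ + 1) (k, σ + 1) * matrixUnit c (k, σ) (k, σ),
      matrixUnit c (i, σ) (j, σ)⁆ = matrixUnit c (k, σ + 1) (k, σ + 1) *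
        ((if k = i then matrixUnit c (k, σ) (j, σ) else 0)
          - (if k = j then matrixUnit c (i, σ) (k, σ) else 0)) := by
    have h1 := hc.matrixUnit_lie (k, σ) (k, σ) (i, σ) (j, σ)
    have h2 := (hc.commute_matrixUnit (p := (k, σ + 1)) (q := (k, σ + 1)) (r := (i, σ))
      (s := (j, σ)) (by simp [hne]) (by simp [hne])).eq
    simp only [Prod.mk.injEq, and_true] at h1
    rw [← h1, Ring.lie_def, Ring.lie_def]
    linear_combination (norm := noncomm_ring) h2 * matrixUnit c (k, σ) (k, σ)
  simp only [interaction, h, sum_lie, h', mul_sub, mul_ite, mul_zero, Finset.sum_sub_distrib,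
    Finset.sum_ite_eq', Finset.mem_univ, if_true, numberDiff, sub_mul]

theorem hopAlong_lie_numberDiff (hτ : Function.Involutive τ) (i j : S) (σ : Fin 2) :
    ⁅hopAlong c τ, numberDiff c i j σ⁆
      = curr c (j, σ) (τ j, σ) - curr c (i, σ) (τ i, σ) := by
  simp only [numberDiff, lie_sub, hc.hopAlong_lie_matrixUnit hτ, curr]
  abel

theorem hopAlong_lie_curr (hτ : Function.Involutive τ) (i j : S) (σ : Fin 2) :
    ⁅hopAlong c τ, curr c (i, σ) (j, σ)⁆
      = hop c (τ i, σ) (j, σ) - hop c (i, σ) (τ j, σ) := by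
  simp only [curr, lie_sub, hc.hopAlong_lie_matrixUnit hτ, hop]
  abel

theorem interaction_lie_numberDiff (i j : S) (σ : Fin 2) :
    ⁅interaction c, numberDiff c i j σ⁆ = 0 := by
  simp [numberDiff, lie_sub, hc.interaction_lie_matrixUnit]

theorem interaction_lie_curr (i j : S) (σ : Fin 2) :
    ⁅interaction c, curr c (i, σ) (j, σ)⁆
      = numberDiff c i j (σ + 1) * hop c (i, σ) (j, σ) := by
  simp only [curr, lie_sub, hc.interaction_lie_matrixUnit, hop, numberDiff]
  noncomm_ring

omit hc [DecidableEq S] in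
/-- A sum over directed bonds is half of the sum over both orientations. -/
theorem two_mul_hopAlong (hτ : Function.Involutive τ) :
    2 * hopAlong c τ = ∑ i, ∑ σ, hop c (τ i, σ) (i, σ) := by
  have h := sum_comp_involutive hτ fun i => ∑ σ, matrixUnit c (τ i, σ) (i, σ)
  simp only [hτ _] at h
  simp only [hop, Finset.sum_add_distrib, two_mul, h, hopAlong]

theorem two_mul_interaction_lie_hopAlong (hτ : Function.Involutive τ) :
    2 * ⁅interaction c, hopAlong c τ⁆
      = ∑ i, ∑ σ, numberDiff c i (τ i) (σ + 1) * curr c (i, σ) (τ i, σ) := by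
  have h := sum_comp_involutive hτ fun i => ∑ σ,
    numberDiff c (τ i) i (σ + 1) * matrixUnit c (τ i, σ) (i, σ)
  simp only [hτ _] at h
  simp only [hopAlong, lie_sum, hc.interaction_lie_matrixUnit, two_mul]
  nth_rw 1 [← h]
  simp only [← Finset.sum_add_distrib]
  refine Finset.sum_congr rfl fun i _ => Finset.sum_congr rfl fun σ _ => ?_
  rw [numberDiff_swap c (τ i) i, curr]
  noncomm_ring

omit [Fintype S] in
theorem norm_numberDiff_le (i j : S) (σ : Fin 2) : ‖numberDiff c i j σ‖ ≤ 1 :=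
  hc.norm_number_sub_number_le _ _

omit [Fintype S] in
theorem norm_numberDiff_mul_hop_le (i j : S) (σ σ' : Fin 2) :
    ‖numberDiff c i j σ * hop c (i, σ') (j, σ')‖ ≤ 1 := by
  rcases eq_or_ne i j with rfl | h
  · simp [numberDiff]
  · refine (norm_mul_le _ _).trans ?_
    exact mul_le_one₀ (hc.norm_numberDiff_le _ _ _) (norm_nonneg _)
      (hc.norm_hop_le (by simpa using h))

theorem norm_hopAlong_le (hτ : Function.Involutive τ) (hfix : ∀ i, τ i ≠ i) :
    ‖hopAlong c τ‖ ≤ Fintype.card S := by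
  refine norm_le_of_two_mul_eq (two_mul_hopAlong hτ) ?_
  refine (norm_sum_sum_le fun i σ => hc.norm_hop_le ?_).trans_eq (mul_one _)
  simpa using hfix i

theorem norm_hopAlong_lie_hopAlong_lie_hopAlong_le (h₁ : Function.Involutive τ₁)
    (h₂ : Function.Involutive τ₂) (hfix : ∀ i, τ₂ i ≠ i) :
    ‖⁅hopAlong c τ₁, ⁅hopAlong c τ₁, hopAlong c τ₂⁆⁆‖ ≤ 4 * Fintype.card S := by
  have h : ⁅hopAlong c τ₁, ⁅hopAlong c τ₁, hopAlong c τ₂⁆⁆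
      = 2 * hopAlong c τ₂ - 2 * hopAlong c (τ₁ ∘ τ₂ ∘ τ₁) := by
    have h := sum_comp_involutive h₁ fun i => ∑ σ, matrixUnit c (τ₁ (τ₂ (τ₁ i)), σ) (i, σ)
    simp only [h₁ _] at h
    have hconj : hopAlong c (τ₁ ∘ τ₂ ∘ τ₁)
        = ∑ i, ∑ σ, matrixUnit c (τ₁ (τ₂ i), σ) (τ₁ i, σ) := h.symm
    have h2 : hopAlong c τ₂ = ∑ i, ∑ σ, matrixUnit c (τ₂ i, σ) (i, σ) := rfl
    rw [hconj, h2]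
    simp only [lie_sum, lie_sub, hc.hopAlong_lie_matrixUnit h₁, h₁ _]
    simp only [two_mul, ← Finset.sum_add_distrib, ← Finset.sum_sub_distrib]
    refine Finset.sum_congr rfl fun i _ => Finset.sum_congr rfl fun σ _ => ?_
    abel
  have hτ : Function.Involutive (τ₁ ∘ τ₂ ∘ τ₁) := fun i => by simp [h₁ _, h₂ _]
  have hfix' (i : S) : (τ₁ ∘ τ₂ ∘ τ₁) i ≠ i := fun hi =>
    hfix (τ₁ i) (by simpa [h₁ _] using congrArg τ₁ hi)
  have hn := hc.norm_hopAlong_le h₂ hfix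
  have hn' := hc.norm_hopAlong_le hτ hfix'
  rw [h, two_mul, two_mul]
  linarith [norm_sub_le (hopAlong c τ₂ + hopAlong c τ₂)
    (hopAlong c (τ₁ ∘ τ₂ ∘ τ₁) + hopAlong c (τ₁ ∘ τ₂ ∘ τ₁)),
    norm_add_le (hopAlong c τ₂) (hopAlong c τ₂),
    norm_add_le (hopAlong c (τ₁ ∘ τ₂ ∘ τ₁)) (hopAlong c (τ₁ ∘ τ₂ ∘ τ₁))]

theorem norm_interaction_lie_interaction_lie_hopAlong_le (hτ : Function.Involutive τ) :
    ‖⁅interaction c, ⁅interaction c, hopAlong c τ⁆⁆‖ ≤ Fintype.card S := by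
  have h : 2 * ⁅interaction c, ⁅interaction c, hopAlong c τ⁆⁆
      = ∑ i, ∑ σ, numberDiff c i (τ i) (σ + 1) *
        (numberDiff c i (τ i) (σ + 1) * hop c (i, σ) (τ i, σ)) := by
    have h2 : 2 * ⁅interaction c, ⁅interaction c, hopAlong c τ⁆⁆
        = ⁅interaction c, 2 * ⁅interaction c, hopAlong c τ⁆⁆ := by
      rw [two_mul, two_mul, lie_add]
    simp only [h2, hc.two_mul_interaction_lie_hopAlong hτ, lie_sum, leibniz_lie_mul,
      hc.interaction_lie_numberDiff, hc.interaction_lie_curr, zero_mul, zero_add]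
  refine norm_le_of_two_mul_eq h ?_
  refine (norm_sum_sum_le fun i σ => ?_).trans_eq (mul_one _)
  exact (norm_mul_le _ _).trans (mul_le_one₀ (hc.norm_numberDiff_le _ _ _) (norm_nonneg _)
    (hc.norm_numberDiff_mul_hop_le _ _ _ _))

theorem two_mul_hopAlong_lie_interaction_lie_hopAlong (h₁ : Function.Involutive τ₁)
    (h₂ : Function.Involutive τ₂) :
    2 * ⁅hopAlong c τ₂, ⁅interaction c, hopAlong c τ₁⁆⁆
      = ∑ i, ∑ σ, ((curr c (τ₁ i, σ + 1) (τ₂ (τ₁ i), σ + 1) - curr c (i, σ + 1) (τ₂ i, σ + 1))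
          * curr c (i, σ) (τ₁ i, σ)
        + numberDiff c i (τ₁ i) (σ + 1)
          * (hop c (τ₂ i, σ) (τ₁ i, σ) - hop c (i, σ) (τ₂ (τ₁ i), σ))) := by
  have h : 2 * ⁅hopAlong c τ₂, ⁅interaction c, hopAlong c τ₁⁆⁆
      = ⁅hopAlong c τ₂, 2 * ⁅interaction c, hopAlong c τ₁⁆⁆ := by
    rw [two_mul, two_mul, lie_add]
  simp only [h, hc.two_mul_interaction_lie_hopAlong h₁, lie_sum, leibniz_lie_mul,
    hc.hopAlong_lie_numberDiff h₂, hc.hopAlong_lie_curr h₂]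

theorem norm_hopAlong_lie_interaction_lie_hopAlong_self_le (hτ : Function.Involutive τ) :
    ‖⁅hopAlong c τ, ⁅interaction c, hopAlong c τ⁆⁆‖ ≤ 4 * Fintype.card S := by
  refine norm_le_of_two_mul_eq (hc.two_mul_hopAlong_lie_interaction_lie_hopAlong hτ hτ) ?_
  refine (norm_sum_sum_le (C := 4) fun i σ => ?_).trans_eq (by ring)
  rw [hτ i, curr_swap c (τ i, σ + 1)]
  have h1 := hc.norm_curr_le (i, σ + 1) (τ i, σ + 1)
  have h2 := hc.norm_curr_le (i, σ) (τ i, σ)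
  have h3 := hc.norm_numberDiff_le i (τ i) (σ + 1)
  have h4 : ‖hop c (τ i, σ) (τ i, σ) - hop c (i, σ) (i, σ)‖ ≤ 2 := by
    have h := hc.norm_numberDiff_le (τ i) i σ
    have : hop c (τ i, σ) (τ i, σ) - hop c (i, σ) (i, σ)
        = numberDiff c (τ i) i σ + numberDiff c (τ i) i σ := by
      simp only [hop, numberDiff]
      abel
    rw [this]
    linarith [norm_add_le (numberDiff c (τ i) i σ) (numberDiff c (τ i) i σ)]
  have h5 : ‖-curr c (i, σ + 1) (τ i, σ + 1) - curr c (i, σ + 1) (τ i, σ + 1)‖ ≤ 2 := by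
    refine (norm_sub_le _ _).trans ?_
    rw [norm_neg]
    linarith
  refine (norm_add_le _ _).trans ?_
  have h6 := norm_mul_le_of_le h5 h2
  have h7 := norm_mul_le_of_le h3 h4
  linarith

theorem norm_interaction_lie_hopAlong_lie_hopAlong_le (h₁ : Function.Involutive τ₁)
    (h₂ : Function.Involutive τ₂) :
    ‖⁅interaction c, ⁅hopAlong c τ₂, hopAlong c τ₁⁆⁆‖ ≤ 2 * Fintype.card S := by
  have h : ⁅interaction c, ⁅hopAlong c τ₂, hopAlong c τ₁⁆⁆ = ∑ i, ∑ σ,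
      numberDiff c (τ₂ (τ₁ i)) i (σ + 1) * hop c (τ₂ (τ₁ i), σ) (i, σ) := by
    have h : ⁅hopAlong c τ₂, hopAlong c τ₁⁆ = ∑ i, ∑ σ, curr c (τ₂ (τ₁ i), σ) (i, σ) := by
      have h := sum_comp_involutive h₁ fun i => ∑ σ, matrixUnit c (τ₁ i, σ) (τ₂ i, σ)
      simp only [h₁ _] at h
      nth_rw 2 [hopAlong]
      simp only [lie_sum, hc.hopAlong_lie_matrixUnit h₂, Finset.sum_sub_distrib, ← h, curr]
    simp only [h, lie_sum, hc.interaction_lie_curr]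
  rw [h]
  exact (norm_sum_sum_le fun i σ => hc.norm_numberDiff_mul_hop_le _ _ _ _).trans_eq (mul_one _)

/-- The mixed commutator of the two hoppings with the interaction, when the three sites `i`,
`τ₁ i`, `τ₂ (τ₁ i)` are distinct: the terms are grouped into three-site operators, one for every
site, of norm at most two. -/
theorem norm_hopAlong_lie_interaction_lie_hopAlong_le (h₁ : Function.Involutive τ₁)
    (h₂ : Function.Involutive τ₂) (hfix₁ : ∀ i, τ₁ i ≠ i) (hfix₂ : ∀ i, τ₂ i ≠ i)
    (hne : ∀ i, τ₂ (τ₁ i) ≠ i) :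
    ‖⁅hopAlong c τ₂, ⁅interaction c, hopAlong c τ₁⁆⁆‖ ≤ 2 * Fintype.card S := by
  let x (i : S) (σ : Fin 2) : R :=
    curr c (τ₁ i, σ + 1) (τ₂ (τ₁ i), σ + 1) * curr c (i, σ) (τ₁ i, σ)
      - numberDiff c i (τ₁ i) (σ + 1) * hop c (i, σ) (τ₂ (τ₁ i), σ)
  have h : 2 * ⁅hopAlong c τ₂, ⁅interaction c, hopAlong c τ₁⁆⁆ = 2 * ∑ i, ∑ σ, x i σ := by
    have h := sum_comp_involutive h₁ fun i => ∑ σ, x i σ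
    rw [hc.two_mul_hopAlong_lie_interaction_lie_hopAlong h₁ h₂, two_mul]
    nth_rw 1 [← h]
    simp only [← Finset.sum_add_distrib]
    refine Finset.sum_congr rfl fun i _ => Finset.sum_congr rfl fun σ _ => ?_
    simp only [x, h₁ i]
    rw [curr_swap c (τ₁ i, σ) (i, σ), numberDiff_swap c (τ₁ i) i,
      hop_comm c (τ₁ i, σ) (τ₂ i, σ)]
    noncomm_ring
  rw [eq_of_two_mul_eq h]
  refine (norm_sum_le_of_le _ fun i _ => (?_ : ‖∑ σ, x i σ‖ ≤ 2)).trans_eq (by simp [mul_comm])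
  rw [Fin.sum_univ_two]
  have a1 := (hfix₁ i).symm
  have a2 := (hfix₂ (τ₁ i)).symm
  have a3 := (hne i).symm
  exact hc.norm_three_site_le (p := (i, 0)) (q := (τ₁ i, 0)) (s := (τ₂ (τ₁ i), 0))
    (p' := (i, 1)) (q' := (τ₁ i, 1)) (s' := (τ₂ (τ₁ i), 1))
    (by simpa using a1) (by simpa using a2) (by simpa using a3)
    (by simpa using a1) (by simpa using a2) (by simpa using a3) (by simp)

end IsCAR

end Lattice

/-! ### The Jordan-Wigner representation -/

namespace FermiHubbard

variable {L : ℕ} [NeZero L]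

/-- The Jordan-Wigner sign of a mode in a basis state: `-1` to the number of occupied modes that
precede it. -/
def jwSign {L : ℕ} (p : Mode L) (t : Finset (Mode L)) : ℂ :=
  (-1) ^ (t.filter fun q => modeIndex q < modeIndex p).card

theorem modeIndex_injective : Function.Injective (modeIndex (L := L)) := by
  rintro ⟨i, σ⟩ ⟨j, ρ⟩ h
  simp only [modeIndex] at h
  have h1 : i.val = j.val := by omega
  have h2 : σ.val = ρ.val := by omega
  rw [ZMod.val_injective L h1, Fin.ext h2]

theorem jwSign_mul_self {L : ℕ} (p : Mode L) (t : Finset (Mode L)) :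
    jwSign p t * jwSign p t = 1 := by
  rw [jwSign, ← pow_add, ← two_mul, pow_mul]
  simp

theorem jwSign_insert {L : ℕ} {p q : Mode L} {t : Finset (Mode L)} (hq : q ∉ t) :
    jwSign p (insert q t)
      = if modeIndex q < modeIndex p then -jwSign p t else jwSign p t := by
  rw [jwSign, Finset.filter_insert]
  split_ifs with h
  · rw [Finset.card_insert_of_notMem (by simp [hq]), pow_succ, jwSign]
    ring
  · rfl

theorem jwSign_erase {L : ℕ} {p q : Mode L} {t : Finset (Mode L)} (hq : q ∈ t) :
    jwSign p (t.erase q)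
      = if modeIndex q < modeIndex p then -jwSign p t else jwSign p t := by
  have h := jwSign_insert (p := p) (Finset.notMem_erase q t)
  rw [Finset.insert_erase hq] at h
  rw [h]
  split_ifs <;> simp

theorem annihilate_apply {L : ℕ} (p : Mode L) (s t : Finset (Mode L)) :
    annihilate p.1 p.2 s t = if p ∈ t ∧ s = t.erase p then jwSign p t else 0 := rfl

theorem create_apply {L : ℕ} (p : Mode L) (s t : Finset (Mode L)) :
    create p.1 p.2 s t = if p ∉ t ∧ s = insert p t then jwSign p t else 0 := by
  rw [create, Matrix.conjTranspose_apply, annihilate_apply]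
  by_cases h : p ∉ t ∧ s = insert p t
  · obtain ⟨h1, rfl⟩ := h
    rw [if_pos (by simp [h1]), if_pos ⟨h1, rfl⟩, jwSign_insert h1, if_neg (lt_irrefl _), jwSign]
    simp
  · rw [if_neg h, if_neg, star_zero]
    rintro ⟨h1, rfl⟩
    exact h ⟨Finset.notMem_erase _ _, (Finset.insert_erase h1).symm⟩

theorem mul_annihilate_apply (M : FockOp L) (p : Mode L) (s t : Finset (Mode L)) :
    (M * annihilate p.1 p.2) s t = if p ∈ t then M s (t.erase p) * jwSign p t else 0 := by
  simp [Matrix.mul_apply, annihilate_apply, ite_and]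

theorem mul_create_apply (M : FockOp L) (p : Mode L) (s t : Finset (Mode L)) :
    (M * create p.1 p.2) s t = if p ∉ t then M s (insert p t) * jwSign p t else 0 := by
  simp [Matrix.mul_apply, create_apply, ite_and]

/-- The Jordan-Wigner operators satisfy the canonical anticommutation relations. -/
theorem isCAR_annihilate : IsCAR fun p : Mode L => annihilate p.1 p.2 where
  anticomm p q := by
    ext s t
    rw [Matrix.add_apply, mul_annihilate_apply, mul_annihilate_apply, annihilate_apply,
      annihilate_apply]
    rcases eq_or_ne p q with rfl | hpq
    · simp
    · by_cases hp : p ∈ t <;> by_cases hq : q ∈ t <;>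
        simp only [hp, hq, Finset.mem_erase, ne_eq, hpq, hpq.symm, not_false_eq_true, true_and,
          if_true, if_false, false_and, and_false, zero_mul, add_zero, Matrix.zero_apply]
      rw [Finset.erase_right_comm (a := q), jwSign_erase hp, jwSign_erase hq]
      rcases lt_or_gt_of_ne (fun h => hpq (modeIndex_injective h)) with h | h <;>
        simp only [h, h.not_gt, if_true, if_false] <;> split_ifs <;> ring
  anticomm_star p q := by
    ext s t
    change (annihilate p.1 p.2 * create q.1 q.2 + create q.1 q.2 * annihilate p.1 p.2) s t = _
    rw [Matrix.add_apply, mul_annihilate_apply, mul_create_apply, annihilate_apply, create_apply]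
    rcases eq_or_ne p q with rfl | hpq
    · by_cases hp : p ∈ t
      · simp only [hp, jwSign_erase hp, Finset.insert_erase hp, Matrix.one_apply, if_true]
        by_cases hs : s = t <;> simp [hs, jwSign_mul_self]
      · simp only [hp, jwSign_insert hp, Finset.erase_insert hp, Matrix.one_apply, if_true]
        by_cases hs : s = t <;> simp [hs, jwSign_mul_self]
    · rw [if_neg hpq]
      by_cases hp : p ∈ t <;> by_cases hq : q ∈ t <;>
        simp only [hp, hq, Finset.mem_erase, Finset.mem_insert, ne_eq, hpq, hpq.symm,
          not_false_eq_true, not_true_eq_false, true_and, or_true, or_false, and_true,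
          if_true, if_false, false_and, and_false, zero_mul, add_zero, Matrix.zero_apply]
      rw [Finset.erase_insert_of_ne hpq.symm, jwSign_erase hp, jwSign_insert hq]
      rcases lt_or_gt_of_ne (fun h => hpq (modeIndex_injective h)) with h | h <;>
        simp only [h, h.not_gt, if_true, if_false] <;> split_ifs <;> ring

/-! ### The even-odd decomposition of the chain -/

/-- The other end of the even-odd bond at a site. -/
def evenOddPartner (L : ℕ) (i : ZMod L) : ZMod L := if Even i.val then i + 1 else i - 1

/-- The other end of the odd-even bond at a site. -/
def oddEvenPartner (L : ℕ) (i : ZMod L) : ZMod L := if Even i.val then i - 1 else i + 1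

theorem even_val_iff (hL : Even L) (i : ZMod L) :
    Even i.val ↔ ZMod.castHom hL.two_dvd (ZMod 2) i = 0 := by
  rw [ZMod.castHom_apply, ← ZMod.natCast_val, ZMod.natCast_eq_zero_iff_even]

theorem even_val_add_one (hL : Even L) (i : ZMod L) : Even (i + 1).val ↔ ¬Even i.val := by
  rw [even_val_iff hL, even_val_iff hL, map_add, map_one]
  generalize ZMod.castHom hL.two_dvd (ZMod 2) i = x
  revert x
  decide

theorem even_val_sub_one (hL : Even L) (i : ZMod L) : Even (i - 1).val ↔ ¬Even i.val := by
  have := even_val_add_one hL (i - 1)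
  rw [sub_add_cancel] at this
  tauto

theorem one_ne_zero_of_even (hL : Even L) : (1 : ZMod L) ≠ 0 := by
  intro h
  have := even_val_add_one hL 0
  rw [zero_add, h] at this
  tauto

theorem evenOddPartner_involutive (hL : Even L) : Function.Involutive (evenOddPartner L) := by
  intro i
  by_cases h : Even i.val <;>
    simp [evenOddPartner, h, even_val_add_one hL, even_val_sub_one hL]

theorem oddEvenPartner_involutive (hL : Even L) : Function.Involutive (oddEvenPartner L) := by
  intro i
  by_cases h : Even i.val <;>
    simp [oddEvenPartner, h, even_val_add_one hL, even_val_sub_one hL]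

theorem evenOddPartner_ne (hL : Even L) (i : ZMod L) : evenOddPartner L i ≠ i := by
  have := one_ne_zero_of_even hL
  by_cases h : Even i.val <;> simp [evenOddPartner, h, sub_eq_self, this]

theorem oddEvenPartner_ne (hL : Even L) (i : ZMod L) : oddEvenPartner L i ≠ i := by
  have := one_ne_zero_of_even hL
  by_cases h : Even i.val <;> simp [oddEvenPartner, h, sub_eq_self, this]

/-- The two bonds at a site lead to different neighbours, unless the chain has only two sites. -/
theorem oddEvenPartner_evenOddPartner_ne_or_eq (hL : Even L) :
    (∀ i, oddEvenPartner L (evenOddPartner L i) ≠ i) ∨ evenOddPartner L = oddEvenPartner L := by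
  by_cases h2 : (2 : ZMod L) = 0
  · right
    have h : (1 : ZMod L) = -1 := by
      rw [eq_neg_iff_add_eq_zero, one_add_one_eq_two, h2]
    funext i
    simp only [evenOddPartner, oddEvenPartner, sub_eq_add_neg, ← h, ite_self]
  · left
    intro i hi
    by_cases h : Even i.val
    · simp only [evenOddPartner, oddEvenPartner, h, even_val_add_one hL, if_true, not_true_eq_false,
        if_false, add_assoc, one_add_one_eq_two, add_eq_left] at hi
      exact h2 hi
    · simp only [evenOddPartner, oddEvenPartner, h, even_val_sub_one hL, if_false, if_true,
        not_false_eq_true, sub_sub, one_add_one_eq_two, sub_eq_self] at hi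
      exact h2 hi

/-- The shift by one site identifies the odd with the even sites. -/
theorem sum_evenSites_add (hL : Even L) (f : ZMod L → FockOp L) :
    ∑ i ∈ evenSites L, (f i + f (i + 1)) = ∑ i, f i := by
  rw [Finset.sum_add_distrib, ← Finset.sum_filter_add_sum_filter_not Finset.univ
    (fun i : ZMod L => Even i.val) f]
  congr 1
  refine Finset.sum_bij' (fun i _ => i + 1) (fun i _ => i - 1) ?_ ?_ ?_ ?_ ?_
  · intro i hi
    simpa [evenSites, even_val_add_one hL, -Nat.not_even_iff_odd] using hi
  · intro i hi
    simpa [evenSites, even_val_sub_one hL] using hi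
  all_goals simp

theorem sum_evenSites_sub (hL : Even L) (f : ZMod L → FockOp L) :
    ∑ i ∈ evenSites L, (f i + f (i - 1)) = ∑ i, f i := by
  rw [Finset.sum_add_distrib, ← Finset.sum_filter_add_sum_filter_not Finset.univ
    (fun i : ZMod L => Even i.val) f]
  congr 1
  refine Finset.sum_bij' (fun i _ => i - 1) (fun i _ => i + 1) ?_ ?_ ?_ ?_ ?_
  · intro i hi
    simpa [evenSites, even_val_sub_one hL, -Nat.not_even_iff_odd] using hi
  · intro i hi
    simpa [evenSites, even_val_add_one hL] using hi
  all_goals simp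

theorem H1_eq (hL : Even L) (v : ℝ) : H1 L v
    = (v : ℂ) • hopAlong (fun p : Mode L => annihilate p.1 p.2) (evenOddPartner L) := by
  rw [H1, hopAlong, ← sum_evenSites_add hL]
  congr 1
  refine Finset.sum_congr rfl fun i hi => ?_
  have hi : Even i.val := by simpa [evenSites] using hi
  simp only [evenOddPartner, hi, even_val_add_one hL, if_true, not_true_eq_false, if_false,
    add_sub_cancel_right, ← Finset.sum_add_distrib]
  exact Finset.sum_congr rfl fun σ _ => add_comm _ _

theorem H2_eq (hL : Even L) (v : ℝ) : H2 L v
    = (v : ℂ) • hopAlong (fun p : Mode L => annihilate p.1 p.2) (oddEvenPartner L) := by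
  rw [H2, hopAlong, ← sum_evenSites_sub hL]
  congr 1
  refine Finset.sum_congr rfl fun i hi => ?_
  have hi : Even i.val := by simpa [evenSites] using hi
  simp only [oddEvenPartner, hi, even_val_sub_one hL, if_true, not_true_eq_false, if_false,
    sub_add_cancel, ← Finset.sum_add_distrib]
  rfl

theorem H3_eq (hL : Even L) (u : ℝ) : H3 L u
    = (u : ℂ) • interaction (fun p : Mode L => annihilate p.1 p.2) := by
  rw [H3, sum_evenSites_add hL fun i => number i 0 * number i 1]
  rfl

theorem hamiltonian_eq (hL : Even L) (v u : ℝ) :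
    hamiltonian L v u = H1 L v + H2 L v + H3 L u := by
  rw [hamiltonian, H3, sum_evenSites_add hL fun i => number i 0 * number i 1, H1, H2,
    ← sum_evenSites_sub hL, Finset.sum_add_distrib, smul_add]
  simp only [sub_add_cancel]

end FermiHubbard

/-! ### The Trotter error -/

section TrotterError

open NormedSpace

attribute [local instance] LieRing.ofAssociativeRing

theorem smul_lie_smul_lie_smul {R : Type*} [CStarAlgebra R] (x y z : ℂ) (X Y Z : R) :
    ⁅x • X, ⁅y • Y, z • Z⁆⁆ = (x * y * z) • ⁅X, ⁅Y, Z⁆⁆ := by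
  simp only [smul_lie, lie_smul, smul_smul]
  congr 1
  ring

theorem lie_interaction_expand {R : Type*} [CStarAlgebra R] (v u : ℂ) (X Y D : R) :
    ⁅v • Y + u • D, ⁅v • Y + u • D, X⁆⁆
      = (v * v) • ⁅Y, ⁅Y, X⁆⁆ + (v * u) • (⁅Y, ⁅D, X⁆⁆ + ⁅D, ⁅Y, X⁆⁆) + (u * u) • ⁅D, ⁅D, X⁆⁆ := by
  simp only [add_lie, lie_add, smul_lie, lie_smul, smul_add, smul_smul, mul_comm u v]
  abel

theorem isSelfAdjoint_hopAlong {S R : Type*} [Fintype S] [CStarAlgebra R] {c : S × Fin 2 → R}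
    {τ : S → S} (hτ : Function.Involutive τ) : IsSelfAdjoint (hopAlong c τ) := by
  have h := sum_comp_involutive hτ fun i => ∑ σ, matrixUnit c (i, σ) (τ i, σ)
  simp only [hτ _] at h
  simp only [IsSelfAdjoint, hopAlong, star_sum, star_matrixUnit, h]

theorem IsCAR.isSelfAdjoint_interaction {S R : Type*} [Fintype S] [DecidableEq S] [CStarAlgebra R]
    {c : S × Fin 2 → R} (hc : IsCAR c) : IsSelfAdjoint (interaction c) := by
  simp only [IsSelfAdjoint, interaction, star_sum, star_mul, star_matrixUnit]
  exact Finset.sum_congr rfl fun i _ => (hc.commute_number _ _).eq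

theorem smul_mem_skewAdjoint {R : Type*} [CStarAlgebra R] {X : R} (hX : IsSelfAdjoint X) (x : ℝ) :
    (-(Complex.I * x)) • X ∈ skewAdjoint R := by
  rw [skewAdjoint.mem_iff, star_smul, hX.star_eq]
  simp

/-- The error of the Strang formula for hopping along two involutions and the on-site
interaction. -/
theorem IsCAR.norm_strang_sub_le {S R : Type*} [Fintype S] [DecidableEq S] [CStarAlgebra R]
    {c : S × Fin 2 → R} (hc : IsCAR c) {τ₁ τ₂ : S → S} (h₁ : Function.Involutive τ₁)
    (h₂ : Function.Involutive τ₂) (hfix₁ : ∀ i, τ₁ i ≠ i) (hfix₂ : ∀ i, τ₂ i ≠ i)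
    (hne : (∀ i, τ₂ (τ₁ i) ≠ i) ∨ τ₁ = τ₂) (v u : ℝ) {t : ℝ} (ht : 0 ≤ t) {A B C : R}
    (hA : A = (-(Complex.I * (v / 2 : ℝ))) • hopAlong c τ₁)
    (hB : B = (-(Complex.I * (v / 2 : ℝ))) • hopAlong c τ₂)
    (hC : C = (-(Complex.I * u)) • interaction c) :
    ‖exp (t • A) * (exp (t • B) * exp (t • C) * exp (t • B)) * exp (t • A)
        - exp (t • (A + (B + C + B) + A))‖
      ≤ Fintype.card S * (t ^ 3 / 6 * (3 * |v| ^ 3 + 4 * |v| ^ 2 * |u| + |v| * |u| ^ 2)) := by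
  have hAs : A ∈ skewAdjoint R := hA ▸ smul_mem_skewAdjoint (isSelfAdjoint_hopAlong h₁) _
  have hBs : B ∈ skewAdjoint R := hB ▸ smul_mem_skewAdjoint (isSelfAdjoint_hopAlong h₂) _
  have hCs : C ∈ skewAdjoint R := hC ▸ smul_mem_skewAdjoint hc.isSelfAdjoint_interaction _
  have hM : B + C + B
      = (-Complex.I) • ((v : ℂ) • hopAlong c τ₂ + (u : ℂ) • interaction c) := by
    rw [hB, hC]
    push_cast
    module
  set T₁ := hopAlong c τ₁
  set T₂ := hopAlong c τ₂
  set D := interaction c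
  set n : ℝ := (Fintype.card S : ℝ) with hn
  have b112 : ‖⁅T₁, ⁅T₁, T₂⁆⁆‖ ≤ 4 * n :=
    hc.norm_hopAlong_lie_hopAlong_lie_hopAlong_le h₁ h₂ hfix₂
  have b221 : ‖⁅T₂, ⁅T₂, T₁⁆⁆‖ ≤ 4 * n :=
    hc.norm_hopAlong_lie_hopAlong_lie_hopAlong_le h₂ h₁ hfix₁
  have b331 : ‖⁅D, ⁅D, T₁⁆⁆‖ ≤ n := hc.norm_interaction_lie_interaction_lie_hopAlong_le h₁
  have b332 : ‖⁅D, ⁅D, T₂⁆⁆‖ ≤ n := hc.norm_interaction_lie_interaction_lie_hopAlong_le h₂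
  have b113 : ‖⁅T₁, ⁅T₁, D⁆⁆‖ ≤ 4 * n := by
    rw [← lie_skew T₁ D, lie_neg, norm_neg]
    exact hc.norm_hopAlong_lie_interaction_lie_hopAlong_self_le h₁
  have b223 : ‖⁅T₂, ⁅T₂, D⁆⁆‖ ≤ 4 * n := by
    rw [← lie_skew T₂ D, lie_neg, norm_neg]
    exact hc.norm_hopAlong_lie_interaction_lie_hopAlong_self_le h₂
  -- On a chain of two sites both hoppings agree, and the second commutator vanishes.
  have bmix : ‖⁅T₂, ⁅D, T₁⁆⁆ + ⁅D, ⁅T₂, T₁⁆⁆‖ ≤ 4 * n := by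
    rcases hne with hne | rfl
    · have := hc.norm_hopAlong_lie_interaction_lie_hopAlong_le h₁ h₂ hfix₁ hfix₂ hne
      have := hc.norm_interaction_lie_hopAlong_lie_hopAlong_le h₁ h₂
      linarith [norm_add_le ⁅T₂, ⁅D, T₁⁆⁆ ⁅D, ⁅T₂, T₁⁆⁆]
    · rw [lie_self, lie_zero, add_zero]
      exact hc.norm_hopAlong_lie_interaction_lie_hopAlong_self_le h₁
  have hv := abs_nonneg v
  have hu := abs_nonneg u
  have e1 : ‖⁅B + C + B, ⁅B + C + B, A⁆⁆‖
      ≤ |v| / 2 * (|v| * |v| * (4 * n) + |v| * |u| * (4 * n) + |u| * |u| * n) := by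
    rw [hM, hA, smul_lie_smul_lie_smul, lie_interaction_expand, norm_smul]
    refine mul_le_mul (by simp) ?_ (norm_nonneg _) (by positivity)
    refine (norm_add₃_le).trans ?_
    simp only [norm_smul, norm_mul, Complex.norm_real, Real.norm_eq_abs]
    gcongr
  have e2 : ‖⁅A, ⁅A, B + C + B⁆⁆‖ ≤ |v| / 2 * (|v| / 2) * (|v| * (4 * n) + |u| * (4 * n)) := by
    rw [hM, hA, smul_lie_smul_lie_smul, norm_smul]
    refine mul_le_mul (by simp) ?_ (norm_nonneg _) (by positivity)
    simp only [lie_add, lie_smul]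
    refine (norm_add_le _ _).trans ?_
    simp only [norm_smul, Complex.norm_real, Real.norm_eq_abs]
    gcongr
  have e3 : ‖⁅C, ⁅C, B⁆⁆‖ ≤ |u| * |u| * (|v| / 2) * n := by
    rw [hB, hC, smul_lie_smul_lie_smul, norm_smul]
    exact mul_le_mul (by simp) b332 (norm_nonneg _) (by positivity)
  have e4 : ‖⁅B, ⁅B, C⁆⁆‖ ≤ |v| / 2 * (|v| / 2) * |u| * (4 * n) := by
    rw [hB, hC, smul_lie_smul_lie_smul, norm_smul]
    exact mul_le_mul (by simp) b223 (norm_nonneg _) (by positivity)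
  refine (norm_exp_mul_five_sub_le hAs hBs hCs ht).trans ?_
  have ht3 : 0 ≤ t ^ 3 / 6 := by positivity
  calc _ ≤ t ^ 3 / 6 * (|v| / 2 * (|v| * |v| * (4 * n) + |v| * |u| * (4 * n) + |u| * |u| * n)
        + |v| / 2 * (|v| / 2) * (|v| * (4 * n) + |u| * (4 * n))
        + (|u| * |u| * (|v| / 2) * n + |v| / 2 * (|v| / 2) * |u| * (4 * n))) := by gcongr
    _ = _ := by ring

end TrotterError

theorem mainTheorem2 (L : ℕ) [NeZero L] (hL : Even L) (v u t : ℝ) (ht : 0 ≤ t) :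
    1 / (L : ℝ) *
        ‖FermiHubbard.strang
            [FermiHubbard.H1 L v, FermiHubbard.H2 L v, FermiHubbard.H3 L u] t
          - FermiHubbard.evolve (FermiHubbard.hamiltonian L v u) t‖
      ≤ t ^ 3 / 6 * (3 * |v| ^ 3 + 4 * |v| ^ 2 * |u| + |v| * |u| ^ 2) := by
  have key := FermiHubbard.isCAR_annihilate.norm_strang_sub_le
    (FermiHubbard.evenOddPartner_involutive hL) (FermiHubbard.oddEvenPartner_involutive hL)
    (FermiHubbard.evenOddPartner_ne hL) (FermiHubbard.oddEvenPartner_ne hL)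
    (FermiHubbard.oddEvenPartner_evenOddPartner_ne_or_eq hL) v u ht rfl rfl rfl
  set A := (-(Complex.I * (v / 2 : ℝ))) • hopAlong
    (fun p : FermiHubbard.Mode L => FermiHubbard.annihilate p.1 p.2)
    (FermiHubbard.evenOddPartner L)
  set B := (-(Complex.I * (v / 2 : ℝ))) • hopAlong
    (fun p : FermiHubbard.Mode L => FermiHubbard.annihilate p.1 p.2)
    (FermiHubbard.oddEvenPartner L)
  set C := (-(Complex.I * u)) • interaction
    (fun p : FermiHubbard.Mode L => FermiHubbard.annihilate p.1 p.2)
  have h1 : FermiHubbard.evolve (FermiHubbard.H1 L v) (t / 2) = NormedSpace.exp (t • A) := by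
    rw [FermiHubbard.evolve, FermiHubbard.H1_eq hL, ← Complex.coe_smul t]
    congr 1
    push_cast
    module
  have h2 : FermiHubbard.evolve (FermiHubbard.H2 L v) (t / 2) = NormedSpace.exp (t • B) := by
    rw [FermiHubbard.evolve, FermiHubbard.H2_eq hL, ← Complex.coe_smul t]
    congr 1
    push_cast
    module
  have h3 : FermiHubbard.evolve (FermiHubbard.H3 L u) (t / 2)
      * FermiHubbard.evolve (FermiHubbard.H3 L u) (t / 2) = NormedSpace.exp (t • C) := by
    let _ : NormedAlgebra ℚ (FermiHubbard.FockOp L) := .restrictScalars ℚ ℂ _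
    rw [FermiHubbard.evolve, ← NormedSpace.exp_add_of_commute (Commute.refl _),
      FermiHubbard.H3_eq hL, ← Complex.coe_smul t]
    congr 1
    push_cast
    module
  have h4 : FermiHubbard.evolve (FermiHubbard.hamiltonian L v u) t
      = NormedSpace.exp (t • (A + (B + C + B) + A)) := by
    rw [FermiHubbard.evolve, FermiHubbard.hamiltonian_eq hL, FermiHubbard.H1_eq hL,
      FermiHubbard.H2_eq hL, FermiHubbard.H3_eq hL, ← Complex.coe_smul t]
    congr 1
    module
  have h5 : FermiHubbard.strang
      [FermiHubbard.H1 L v, FermiHubbard.H2 L v, FermiHubbard.H3 L u] t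
      = NormedSpace.exp (t • A) * (NormedSpace.exp (t • B) * NormedSpace.exp (t • C)
        * NormedSpace.exp (t • B)) * NormedSpace.exp (t • A) := by
    rw [← h3, ← h1, ← h2]
    simp [FermiHubbard.strang, mul_assoc]
  have hLpos : (0 : ℝ) < L := Nat.cast_pos.mpr (NeZero.pos L)
  rw [h4, h5, one_div_mul_eq_div, div_le_iff₀ hLpos, mul_comm _ (L : ℝ)]
  rwa [ZMod.card] at key
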